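/- Let $\mathscr{P}_2(\mathbb{R}^n)$ be the set of Borel probability measures on $\mathbb{R}^n$ with finite second moment, with the topology of the $2$-Wasserstein distance $W_2$. Let $\sigma,\mu,\nu\in\mathscr{P}_2(\mathbb{R}^n)$, where $\sigma$ is absolutely continuous with respect to Lebesgue measure. For $\rho\in\mathscr{P}_2(\mathbb{R}^n)$ let $F_\sigma(\rho)\in L^2(\mathbb{R}^n,\sigma)$ (the LOT embedding) be the optimal transport map from $\sigma$ to $\rho$, i.e. the minimizer, unique $\sigma$-a.e., of $\int\|T(x)-x\|^2\,d\sigma(x)$ among all maps $T:\mathbb{R}^n\to\mathbb{R}^n$ with $T_\sharp\sigma=\rho$. Let $\mathcal{H}$ be a convex set of maps $h:\mathbb{R}^n\to\mathbb{R}^n$ (convex for the pointwise linear structure) that are square-integrable with respect to $\sigma$, and put $\mathcal{H}\star\mu=\{h_\sharp\mu : h\in\mathcal{H}\}$ and $\mathcal{H}\star\nu=\{h_\sharp\nu : h\in\mathcal{H}\}$. Assume that $F_\sigma$ is compatible with the $\mu$- and the $\nu$-orbits with respect to the action of $\mathcal{H}$, i.e. that for every $h\in\mathcal{H}$ and each $\rho\in\{\mu,\nu\}$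 the map $h$ is square-integrable with respect to $\rho$ (so that $h_\sharp\rho\in\mathscr{P}_2(\mathbb{R}^n)$) and $$F_\sigma(h_\sharp\rho)=h\circ F_\sigma(\rho)\quad\text{in } L^2(\mathbb{R}^n,\sigma).$$ If $\mathcal{H}\star\mu$ is closed in $\mathscr{P}_2(\mathbb{R}^n)$, $\mathcal{H}\star\nu$ is compact, and these two sets are disjoint, then $F_\sigma(\mathcal{H}\star\mu)$ and $F_\sigma(\mathcal{H}\star\nu)$ are linearly separable in $L^2(\mathbb{R}^n,\sigma)$: there are $w\in L^2(\mathbb{R}^n,\sigma)$ and $b\in\mathbb{R}$ such that $\langle w,f\rangle<b$ for all $f\in F_\sigma(\mathcal{H}\star\mu)$ and $\langle w,g\rangle>b$ for all $g\in F_\sigma(\mathcal{H}\star\nu)$. -/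

import Mathlib

open MeasureTheory Set
open scoped ENNReal

namespace LOT

noncomputable section

/-- Euclidean space `ℝⁿ`. -/
abbrev E (n : ℕ) : Type := EuclideanSpace ℝ (Fin n)

/-- Borel probability measures on `ℝⁿ` with finite second moment. -/
@[ext] structure P2 (n : ℕ) where
  /-- the underlying measure -/
  toMeasure : Measure (E n)
  isProbabilityMeasure : IsProbabilityMeasure toMeasure
  secondMoment_lt_top : ∫⁻ x, ‖x‖ₑ ^ 2 ∂toMeasure < ∞

instance {n : ℕ} (μ : P2 n) : IsProbabilityMeasure μ.toMeasure := μ.isProbabilityMeasure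

/-- The couplings (transport plans) of `μ` and `ν`. -/
def couplings {n : ℕ} (μ ν : P2 n) : Set (Measure (E n × E n)) :=
  {γ | γ.map Prod.fst = μ.toMeasure ∧ γ.map Prod.snd = ν.toMeasure}

/-- The `2`-Wasserstein distance. -/
def W2 {n : ℕ} (μ ν : P2 n) : ℝ≥0∞ :=
  (⨅ γ ∈ couplings μ ν, ∫⁻ p, ‖p.1 - p.2‖ₑ ^ 2 ∂γ) ^ (1 / 2 : ℝ)

/-- The topology of the Wasserstein distance: a set is open if and only if it contains,
with each of its points, a `W2`-ball of positive radius around that point. -/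
instance {n : ℕ} : TopologicalSpace (P2 n) where
  IsOpen U := ∀ μ ∈ U, ∃ ε : ℝ≥0∞, 0 < ε ∧ ∀ ν, W2 μ ν < ε → ν ∈ U
  isOpen_univ := fun _ _ => ⟨1, one_pos, fun _ _ => mem_univ _⟩
  isOpen_inter := by
    rintro U V hU hV μ ⟨hμU, hμV⟩
    obtain ⟨ε, hε, h⟩ := hU μ hμU
    obtain ⟨δ, hδ, h'⟩ := hV μ hμV
    exact ⟨min ε δ, lt_min hε hδ, fun ν hν =>
      ⟨h ν (hν.trans_le (min_le_left _ _)), h' ν (hν.trans_le (min_le_right _ _))⟩⟩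
  isOpen_sUnion := by
    rintro S hS μ ⟨U, hU, hμ⟩
    obtain ⟨ε, hε, h⟩ := hS U hU μ hμ
    exact ⟨ε, hε, fun ν hν => ⟨U, hU, h ν hν⟩⟩

/-- The Hilbert space `L²(ℝⁿ, σ)` of (classes of) maps `ℝⁿ → ℝⁿ`. -/
abbrev L2 {n : ℕ} (σ : P2 n) : Type := Lp (E n) 2 σ.toMeasure

/-- `T` is an optimal transport map from `σ` to `ν` for the quadratic cost: it pushes `σ` to `ν`
and minimizes `∫ ‖T x - x‖² dσ(x)` among all maps that do so. -/
def IsOptimalMap {n : ℕ} (σ ν : P2 n) (T : L2 σ) : Prop :=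
  σ.toMeasure.map T = ν.toMeasure ∧
    ∀ S : E n → E n, Measurable S → σ.toMeasure.map S = ν.toMeasure →
      ∫⁻ x, ‖T x - x‖ₑ ^ 2 ∂σ.toMeasure ≤ ∫⁻ x, ‖S x - x‖ₑ ^ 2 ∂σ.toMeasure

/-- The LOT embedding `F_σ`, sending `ν` to the optimal transport map from `σ` to `ν`.
For absolutely continuous `σ` there is exactly one such map in `L²(ℝⁿ, σ)`, so that the choice
operator picks it. -/
def F {n : ℕ} (σ ν : P2 n) : L2 σ :=
  Classical.epsilon (IsOptimalMap σ ν)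

/-- The push-forward `h ⋆ μ` of `μ` under a map `h` that is square-integrable for `μ`. -/
def push {n : ℕ} (h : E n → E n) (μ : P2 n) (hh : MemLp h 2 μ.toMeasure) : P2 n where
  toMeasure := μ.toMeasure.map h
  isProbabilityMeasure := Measure.isProbabilityMeasure_map hh.aestronglyMeasurable.aemeasurable
  secondMoment_lt_top := by
    rw [lintegral_map' (by fun_prop) hh.aestronglyMeasurable.aemeasurable]
    have := lintegral_rpow_enorm_lt_top_of_eLpNorm_lt_top two_ne_zero ENNReal.ofNat_ne_top hh.2
    simpa using this

/-- The orbit `ℋ ⋆ μ`, the set of all push-forwards of `μ` under maps in `ℋ`. -/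
def orbit {n : ℕ} (H : Set (E n → E n)) (μ : P2 n) : Set (P2 n) :=
  {ρ | ∃ h ∈ H, ∃ hh : MemLp h 2 μ.toMeasure, ρ = push h μ hh}

/-- `F_σ` is compatible with `μ`-orbits with respect to the action of `ℋ`: for all `h ∈ ℋ`,
the push-forward `h ⋆ μ` is in the domain of `F_σ` (that is, `h` is square-integrable for `μ`), and
`F_σ (h ⋆ μ) = h ∘ F_σ μ` in `L²(ℝⁿ, σ)`. -/
def Compatible {n : ℕ} (σ μ : P2 n) (H : Set (E n → E n)) : Prop :=
  ∀ h ∈ H, ∃ hh : MemLp h 2 μ.toMeasure,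
    (F σ (push h μ hh) : E n → E n) =ᵐ[σ.toMeasure] h ∘ (F σ μ : E n → E n)

/-- Two subsets of a real inner product space are linearly separable: they lie strictly on
different sides of a hyperplane `⟪w, ·⟫ = b` (if both are nonempty, then `w ≠ 0`). -/
def LinearlySeparable {V : Type*} [NormedAddCommGroup V] [InnerProductSpace ℝ V]
    (A B : Set V) : Prop :=
  ∃ (w : V) (b : ℝ), (∀ x ∈ A, inner ℝ w x < b) ∧ ∀ y ∈ B, b < inner ℝ w y

end

end LOT

namespace LOT

open Filter Topology ProbabilityTheory

open scoped RealInnerProductSpace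

/-! Compatibility makes `F σ` of a push-forward affine in `h`, so both images are convex
(`convex_F_image_orbit`). Two maps pushing `σ` to `ρ` and `τ` couple these measures, so `W2 ρ τ` is
at most their L² distance (`W2_le_edist`). Hence the positive gap between a closed set and a
disjoint compact one (`exists_pos_forall_le_W2`) survives in L², and Hahn–Banach applied to
thickenings separates; the images need not be closed or compact.

What remains is that `F σ ρ` really pushes `σ` to `ρ` (`map_F`), which requires existence of an
optimal map, not uniqueness. An optimal plan exists by tightness and lower semicontinuity; its
support is monotone, as otherwise exchanging targets would lower the cost; a monotone set is
single-valued above almost every point, so the plan lives on a graph. -/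

/-- A subset of `V × V` is monotone. -/
def IsMonotoneSet {V : Type*} [NormedAddCommGroup V] [InnerProductSpace ℝ V]
    (Γ : Set (V × V)) : Prop :=
  ∀ p ∈ Γ, ∀ q ∈ Γ, 0 ≤ ⟪p.1 - q.1, p.2 - q.2⟫

/-! ### Monotone sets are almost everywhere single-valued -/

section Monotone

variable {V : Type*} [NormedAddCommGroup V] [InnerProductSpace ℝ V]

/-- A set contained in a cone transversal to `e`, around each of its points, is a null set. -/
theorem volume_eq_zero_of_transversal [FiniteDimensional ℝ V] [MeasurableSpace V] [BorelSpace V]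
    {S : Set V} {e : V} {r : ℝ} (hr : r < ‖e‖) (he : e ≠ 0)
    (hS : ∀ x ∈ S, ∀ y ∈ S, ⟪e, x - y⟫ ≤ r * ‖x - y‖) : (volume : Measure V) S = 0 := by
  have hS' : ∀ x ∈ closure S, ∀ y ∈ closure S, ⟪e, x - y⟫ ≤ r * ‖x - y‖ := by
    have hcl : IsClosed {p : V × V | ⟪e, p.1 - p.2⟫ ≤ r * ‖p.1 - p.2‖} :=
      isClosed_le (by fun_prop) (by fun_prop)
    intro x hx y hy
    have : (x, y) ∈ closure (S ×ˢ S) := by rw [closure_prod_eq]; exact ⟨hx, hy⟩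
    exact closure_minimal (fun p hp => hS _ hp.1 _ hp.2) hcl this
  -- No two points differ by a positive multiple of `e`, so the translates by `e / (k + 1)` are
  -- disjoint: infinitely many, of equal measure, by bounded vectors.
  have key : ∀ t : ℝ, 0 < t → ∀ x ∈ closure S, x + t • e ∉ closure S := by
    intro t ht x hx hxt
    have h := hS' _ hxt _ hx
    rw [add_sub_cancel_left, inner_smul_right, real_inner_self_eq_norm_sq, norm_smul,
      Real.norm_of_nonneg ht.le] at h
    have h0 : 0 < ‖e‖ := norm_pos_iff.mpr he
    nlinarith [mul_pos ht (mul_pos h0 (sub_pos.mpr hr))]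
  refine measure_mono_null subset_closure
    (Measure.addHaar_eq_zero_of_disjoint_translates volume (fun k : ℕ => (1 / ((k : ℝ) + 1)) • e)
      ?_ ?_ isClosed_closure.measurableSet)
  · refine (Metric.isBounded_closedBall (x := (0 : V)) (r := ‖e‖)).subset ?_
    rintro _ ⟨k, rfl⟩
    rw [mem_closedBall_zero_iff, norm_smul, Real.norm_of_nonneg (by positivity)]
    refine mul_le_of_le_one_left (norm_nonneg _) ?_
    rw [div_le_one (by positivity)]
    linarith [(Nat.cast_nonneg k : (0 : ℝ) ≤ k)]
  · refine (pairwise_disjoint_on _).2 ?_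
    intro m k hmk
    simp only [singleton_add]
    rw [Set.disjoint_left]
    rintro _ ⟨x, hx, rfl⟩ ⟨y, hy, hxy⟩
    have ht : 0 < 1 / ((m : ℝ) + 1) - 1 / ((k : ℝ) + 1) := by
      rw [sub_pos]
      apply one_div_lt_one_div_of_lt (by positivity)
      have : (m : ℝ) < k := by exact_mod_cast hmk
      linarith
    refine key _ ht x hx ?_
    have : y = x + (1 / ((m : ℝ) + 1) - 1 / ((k : ℝ) + 1)) • e := by
      rw [sub_smul]
      simp only at hxy
      rw [add_sub, eq_sub_iff_add_eq, add_comm y, hxy, add_comm]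
    rw [← this]; exact hy

/-- A monotone subset of `V × V` has at most one point above almost every point of `V`. -/
theorem IsMonotoneSet.volume_multivalued [FiniteDimensional ℝ V] [MeasurableSpace V] [BorelSpace V]
    {Γ : Set (V × V)} (hΓ : IsMonotoneSet Γ) :
    (volume : Measure V) {x | ∃ y z, (x, y) ∈ Γ ∧ (x, z) ∈ Γ ∧ y ≠ z} = 0 := by
  obtain ⟨D, hDc, hDd⟩ := TopologicalSpace.exists_countable_dense V
  have hsub : {x | ∃ y z, (x, y) ∈ Γ ∧ (x, z) ∈ Γ ∧ y ≠ z} ⊆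
      ⋃ p ∈ D, ⋃ q ∈ D, ⋃ (_ : p ≠ q), {x | ∃ y z, (x, y) ∈ Γ ∧ (x, z) ∈ Γ ∧
        ‖y - p‖ ≤ ‖q - p‖ / 4 ∧ ‖z - q‖ ≤ ‖q - p‖ / 4} := by
    rintro x ⟨y, z, hy, hz, hyz⟩
    have h0 : 0 < dist y z := dist_pos.mpr hyz
    obtain ⟨p, hp, hpD⟩ := hDd.exists_dist_lt y (show 0 < dist y z / 8 by positivity)
    obtain ⟨q, hq, hqD⟩ := hDd.exists_dist_lt z (show 0 < dist y z / 8 by positivity)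
    have h1 : dist y z ≤ dist y p + dist q p + dist z q := by
      have := dist_triangle4 y p q z
      rw [dist_comm p q, dist_comm q z] at this
      exact this
    simp only [mem_iUnion, exists_prop]
    rw [dist_eq_norm] at *
    refine ⟨p, hp, q, hq, ?_, y, z, hy, hz, ?_, ?_⟩
    · rintro rfl
      simp only [dist_eq_norm, sub_self, norm_zero] at *
      linarith
    · simp only [dist_eq_norm] at *; linarith
    · simp only [dist_eq_norm] at *; linarith
  refine measure_mono_null hsub ?_
  rw [measure_biUnion_null_iff hDc]
  intro p _
  rw [measure_biUnion_null_iff hDc]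
  intro q _
  rw [measure_iUnion_null_iff]
  intro hpq
  have hne : q - p ≠ 0 := sub_ne_zero.mpr hpq.symm
  have h0 : 0 < ‖q - p‖ := norm_pos_iff.mpr hne
  refine volume_eq_zero_of_transversal (e := q - p) (r := ‖q - p‖ / 2) (by linarith) hne ?_
  rintro x ⟨y, z, hy, hz, hyp, hzq⟩ x' ⟨y', z', hy', hz', hyp', hzq'⟩
  have hm : 0 ≤ ⟪x' - x, z' - y⟫ := hΓ _ hz' _ hy
  -- Split `q - p = (z' - y) + (y - p) - (z' - q)`: monotonicity makes the first contribution
  -- nonpositive, and each other one is at most `‖q - p‖ / 4 * ‖x - x'‖`.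
  have e1 : ⟪q - p, x - x'⟫ =
      -⟪x' - x, z' - y⟫ - ⟪y - p, x - x'⟫ + -⟪z' - q, x - x'⟫ + 2 * ⟪y - p, x - x'⟫ := by
    rw [real_inner_comm (z' - y) (x' - x), ← neg_sub x x', inner_neg_right]
    simp only [inner_sub_left]
    ring
  have b1 := real_inner_le_norm (y - p) (x - x')
  have b2 := neg_le_of_abs_le (abs_real_inner_le_norm (z' - q) (x - x'))
  have c1 := mul_le_mul_of_nonneg_right hyp (norm_nonneg (x - x'))
  have c2 := mul_le_mul_of_nonneg_right hzq' (norm_nonneg (x - x'))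
  nlinarith

end Monotone

/-! ### Existence of optimal plans -/

theorem isProbabilityMeasure_of_mem_couplings {n : ℕ} {μ ν : P2 n} {γ : Measure (E n × E n)}
    (hγ : γ ∈ couplings μ ν) : IsProbabilityMeasure γ := by
  have h : IsProbabilityMeasure (γ.map Prod.fst) := by rw [hγ.1]; infer_instance
  refine ⟨?_⟩
  have := h.measure_univ
  rwa [Measure.map_apply measurable_fst MeasurableSet.univ, preimage_univ] at this

theorem prod_mem_couplings {n : ℕ} (μ ν : P2 n) :
    μ.toMeasure.prod ν.toMeasure ∈ couplings μ ν := by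
  simp [couplings]

theorem lintegral_sq_sub_lt_top {n : ℕ} {μ ν : P2 n} {γ : Measure (E n × E n)}
    (hγ : γ ∈ couplings μ ν) : ∫⁻ p, ‖p.1 - p.2‖ₑ ^ 2 ∂γ < ∞ := by
  have h1 : ∫⁻ p, ‖p.1‖ₑ ^ 2 ∂γ < ∞ := by
    have := μ.secondMoment_lt_top
    rwa [← hγ.1, lintegral_map (by fun_prop) measurable_fst] at this
  have h2 : ∫⁻ p, ‖p.2‖ₑ ^ 2 ∂γ < ∞ := by
    have := ν.secondMoment_lt_top
    rwa [← hγ.2, lintegral_map (by fun_prop) measurable_snd] at this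
  have m1 : MemLp (fun p : E n × E n => p.1) 2 γ :=
    ⟨by fun_prop, (eLpNorm_lt_top_iff_lintegral_rpow_enorm_lt_top two_ne_zero
      ENNReal.ofNat_ne_top).2 (by simpa using h1)⟩
  have m2 : MemLp (fun p : E n × E n => p.2) 2 γ :=
    ⟨by fun_prop, (eLpNorm_lt_top_iff_lintegral_rpow_enorm_lt_top two_ne_zero
      ENNReal.ofNat_ne_top).2 (by simpa using h2)⟩
  simpa using (eLpNorm_lt_top_iff_lintegral_rpow_enorm_lt_top two_ne_zero
    ENNReal.ofNat_ne_top).1 (m1.sub m2).2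

/-- The mass of a plan outside `K ×ˢ K'` is bounded by the marginal masses outside `K` and `K'`,
which do not depend on the plan. -/
theorem isTightMeasureSet_couplings {n : ℕ} (μ ν : P2 n) :
    IsTightMeasureSet (couplings μ ν) := by
  rw [isTightMeasureSet_iff_exists_isCompact_measure_compl_le]
  intro ε hε
  have hε2 : 0 < ε / 2 := ENNReal.half_pos hε.ne'
  obtain ⟨K, hK, hKε⟩ := isTightMeasureSet_iff_exists_isCompact_measure_compl_le.1
    (isTightMeasureSet_singleton (μ := μ.toMeasure)) _ hε2
  obtain ⟨K', hK', hKε'⟩ := isTightMeasureSet_iff_exists_isCompact_measure_compl_le.1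
    (isTightMeasureSet_singleton (μ := ν.toMeasure)) _ hε2
  refine ⟨K ×ˢ K', hK.prod hK', fun γ hγ => ?_⟩
  have h1 : γ (Prod.fst ⁻¹' Kᶜ) ≤ ε / 2 := by
    rw [← Measure.map_apply measurable_fst hK.measurableSet.compl, hγ.1]
    exact hKε _ rfl
  have h2 : γ (Prod.snd ⁻¹' K'ᶜ) ≤ ε / 2 := by
    rw [← Measure.map_apply measurable_snd hK'.measurableSet.compl, hγ.2]
    exact hKε' _ rfl
  calc γ (K ×ˢ K')ᶜ ≤ γ (Prod.fst ⁻¹' Kᶜ ∪ Prod.snd ⁻¹' K'ᶜ) := by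
        refine measure_mono fun p hp => ?_
        by_contra h
        simp only [mem_union, mem_preimage, mem_compl_iff, not_or, not_not] at h
        exact hp ⟨h.1, h.2⟩
    _ ≤ ε / 2 + ε / 2 := (measure_union_le _ _).trans (add_le_add h1 h2)
    _ = ε := ENNReal.add_halves ε

theorem map_eq_of_tendsto {X Y : Type*} [TopologicalSpace X] [MeasurableSpace X]
    [OpensMeasurableSpace X] [TopologicalSpace Y] [MeasurableSpace Y] [BorelSpace Y]
    [HasOuterApproxClosed Y] {f : X → Y} (hf : Continuous f) {u : ℕ → ProbabilityMeasure X}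
    {P : ProbabilityMeasure X} (hu : Tendsto u atTop (𝓝 P)) {m : Measure Y}
    (h : ∀ k, (u k : Measure X).map f = m) : (P : Measure X).map f = m := by
  have ht := ProbabilityMeasure.tendsto_map_of_tendsto_of_continuous u P hu hf
  have hc : (fun k => (u k).map hf.measurable.aemeasurable) =
      fun _ => (u 0).map hf.measurable.aemeasurable := by
    funext k
    apply Subtype.ext
    exact (h k).trans (h 0).symm
  rw [hc] at ht
  have := tendsto_nhds_unique ht tendsto_const_nhds
  exact (congrArg (fun Q : ProbabilityMeasure Y => (Q : Measure Y)) this).trans (h 0)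

/-- There is an optimal transport plan for the quadratic cost. -/
theorem exists_optimal_coupling {n : ℕ} (μ ν : P2 n) :
    ∃ γ ∈ couplings μ ν, ∀ γ' ∈ couplings μ ν,
      ∫⁻ p, ‖p.1 - p.2‖ₑ ^ 2 ∂γ ≤ ∫⁻ p, ‖p.1 - p.2‖ₑ ^ 2 ∂γ' := by
  set c : Measure (E n × E n) → ℝ≥0∞ := fun γ => ∫⁻ p, ‖p.1 - p.2‖ₑ ^ 2 ∂γ with hc
  obtain ⟨v, -, hv, hvm⟩ := exists_seq_tendsto_sInf (S := c '' couplings μ ν)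
    ⟨_, _, prod_mem_couplings μ ν, rfl⟩ (OrderBot.bddBelow _)
  choose γ hγ hγv using hvm
  let u : ℕ → ProbabilityMeasure (E n × E n) :=
    fun k => ⟨γ k, isProbabilityMeasure_of_mem_couplings (hγ k)⟩
  let S : Set (ProbabilityMeasure (E n × E n)) := {P | (P : Measure (E n × E n)) ∈ couplings μ ν}
  have hS : IsCompact (closure S) := by
    refine isCompact_closure_of_isTightMeasureSet ((isTightMeasureSet_couplings μ ν).subset ?_)
    rintro _ ⟨P, hP, rfl⟩
    exact hP
  obtain ⟨P, -, φ, hφ, hP⟩ := hS.tendsto_subseq (x := u) fun k => subset_closure (hγ k)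
  refine ⟨P, ⟨map_eq_of_tendsto continuous_fst hP fun k => (hγ _).1,
    map_eq_of_tendsto continuous_snd hP fun k => (hγ _).2⟩, fun γ' hγ' => ?_⟩
  -- The cost is continuous and nonnegative but unbounded, so weak convergence gives only lower
  -- semicontinuity, which suffices for a minimizer.
  have hl : c P ≤ atTop.liminf fun k => c (u (φ k)) := by
    have := lintegral_le_liminf_lintegral_of_forall_isOpen_measure_le_liminf_measure
      (μ := (P : Measure (E n × E n))) (μs := fun k => (u (φ k) : Measure (E n × E n)))
      (f := fun p : E n × E n => ‖p.1 - p.2‖ ^ 2) (by fun_prop) (fun p => by positivity)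
      fun G hG => ProbabilityMeasure.le_liminf_measure_open_of_tendsto hP hG
    simpa only [hc, ENNReal.ofReal_pow (norm_nonneg _), ofReal_norm] using this
  have hlim : Tendsto (fun k => c (u (φ k))) atTop (𝓝 (sInf (c '' couplings μ ν))) := by
    have := hv.comp hφ.tendsto_atTop
    refine this.congr fun k => ?_
    exact (hγv (φ k)).symm
  rw [hlim.liminf_eq] at hl
  exact hl.trans (sInf_le ⟨γ', hγ', rfl⟩)

/-! ### Monotonicity of optimal plans -/

theorem sq_enorm_cross_lt {n : ℕ} {p q : E n × E n} (h : ⟪p.1 - q.1, p.2 - q.2⟫ < 0) :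
    ‖p.1 - q.2‖ₑ ^ 2 + ‖q.1 - p.2‖ₑ ^ 2 < ‖p.1 - p.2‖ₑ ^ 2 + ‖q.1 - q.2‖ₑ ^ 2 := by
  simp only [← ofReal_norm, ← ENNReal.ofReal_pow (norm_nonneg _)]
  rw [← ENNReal.ofReal_add (by positivity) (by positivity),
    ← ENNReal.ofReal_add (by positivity) (by positivity), ENNReal.ofReal_lt_ofReal_iff_of_nonneg
    (by positivity)]
  simp only [norm_sub_sq_real]
  simp only [inner_sub_left, inner_sub_right] at h
  linarith

/-- An optimal plan cannot be improved by exchanging the targets of pairs of points, so the pairs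
for which this would be profitable form a null set. -/
theorem optimal_coupling_prod_null {n : ℕ} {μ ν : P2 n} {γ : Measure (E n × E n)}
    (hγ : γ ∈ couplings μ ν)
    (hopt : ∀ γ' ∈ couplings μ ν, ∫⁻ p, ‖p.1 - p.2‖ₑ ^ 2 ∂γ ≤ ∫⁻ p, ‖p.1 - p.2‖ₑ ^ 2 ∂γ') :
    γ.prod γ {z | ⟪z.1.1 - z.2.1, z.1.2 - z.2.2⟫ < 0} = 0 := by
  have := isProbabilityMeasure_of_mem_couplings hγ
  set D : Set ((E n × E n) × (E n × E n)) := {z | ⟪z.1.1 - z.2.1, z.1.2 - z.2.2⟫ < 0} with hD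
  have hDo : IsOpen D := isOpen_lt (by fun_prop) (by fun_prop)
  have hDm : MeasurableSet D := hDo.measurableSet
  have hswap : ∀ f : (E n × E n) × (E n × E n) → ℝ≥0∞, Measurable f →
      ∫⁻ z in D, f z.swap ∂(γ.prod γ) = ∫⁻ z in D, f z ∂(γ.prod γ) := by
    intro f hf
    have hDs : Prod.swap ⁻¹' D = D := by
      ext z
      simp only [hD, mem_preimage, mem_ofPred_eq, Prod.fst_swap, Prod.snd_swap]
      rw [← neg_sub z.1.1, ← neg_sub z.1.2, inner_neg_neg]
    conv_rhs => rw [← Measure.prod_swap (μ := γ) (ν := γ)]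
    rw [setLIntegral_map hDm hf measurable_swap, hDs]
  -- Competing plan: draw two independent pairs from `γ` and, on `D`, send the first source to the
  -- second target. The second marginal stays `ν` because `D` and `γ.prod γ` are invariant under
  -- swapping the pairs.
  let g : (E n × E n) × (E n × E n) → E n := D.piecewise (fun z => z.2.2) (fun z => z.1.2)
  have hg : Measurable g := Measurable.piecewise hDm (by fun_prop) (by fun_prop)
  have hint : ∀ f : (E n × E n) → ℝ≥0∞, Measurable f →
      ∫⁻ p, f p ∂((γ.prod γ).map fun z => (z.1.1, g z)) =
        ∫⁻ z in D, f (z.1.1, z.2.2) ∂(γ.prod γ) + ∫⁻ z in Dᶜ, f z.1 ∂(γ.prod γ) := by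
    intro f hf
    rw [lintegral_map hf (by fun_prop), ← lintegral_add_compl _ hDm]
    congr 1
    · refine setLIntegral_congr_fun hDm fun z hz => ?_
      simp [g, hz]
    · refine setLIntegral_congr_fun hDm.compl fun z hz => ?_
      simp only [g, piecewise_eq_of_notMem _ _ _ hz]
  have hfst : ∀ f : (E n × E n) → ℝ≥0∞, Measurable f →
      ∫⁻ z in D, f z.1 ∂(γ.prod γ) + ∫⁻ z in Dᶜ, f z.1 ∂(γ.prod γ) = ∫⁻ p, f p ∂γ := by
    intro f hf
    rw [lintegral_add_compl _ hDm, ← lintegral_map (f := f) (g := Prod.fst) hf measurable_fst,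
      Measure.map_fst_prod]
    simp
  have hmem : (γ.prod γ).map (fun z => (z.1.1, g z)) ∈ couplings μ ν := by
    constructor
    · rw [Measure.map_map measurable_fst (by fun_prop), ← hγ.1]
      have : (Prod.fst ∘ fun z : (E n × E n) × (E n × E n) => (z.1.1, g z)) =
          Prod.fst ∘ Prod.fst := rfl
      rw [this, ← Measure.map_map measurable_fst measurable_fst, Measure.map_fst_prod]
      simp
    · rw [← hγ.2]
      refine Measure.ext_of_lintegral _ fun f hf => ?_
      rw [lintegral_map hf measurable_snd, lintegral_map hf measurable_snd, hint _ (by fun_prop),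
        ← hfst _ (by fun_prop)]
      congr 1
      exact hswap (fun z => f z.1.2) (by fun_prop)
  have hle := hopt _ hmem
  rw [hint _ (by fun_prop), ← hfst _ (by fun_prop)] at hle
  have hfin : ∫⁻ z in Dᶜ, ‖z.1.1 - z.1.2‖ₑ ^ 2 ∂(γ.prod γ) ≠ ∞ := by
    have h := lintegral_sq_sub_lt_top hγ
    rw [← hfst _ (by fun_prop)] at h
    exact (ENNReal.add_lt_top.1 h).2.ne
  have hle' := (ENNReal.add_le_add_iff_right hfin).1 hle
  have hX : ∫⁻ z in D, ‖z.1.1 - z.2.2‖ₑ ^ 2 ∂(γ.prod γ) ≠ ∞ := by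
    have h := lintegral_sq_sub_lt_top hmem
    rw [hint _ (by fun_prop)] at h
    exact (ENNReal.add_lt_top.1 h).1.ne
  by_contra hne
  have hs : ∫⁻ z in D, ‖z.2.1 - z.1.2‖ₑ ^ 2 ∂(γ.prod γ) =
      ∫⁻ z in D, ‖z.1.1 - z.2.2‖ₑ ^ 2 ∂(γ.prod γ) :=
    hswap (fun z => ‖z.1.1 - z.2.2‖ₑ ^ 2) (by fun_prop)
  have hs' : ∫⁻ z in D, ‖z.2.1 - z.2.2‖ₑ ^ 2 ∂(γ.prod γ) =
      ∫⁻ z in D, ‖z.1.1 - z.1.2‖ₑ ^ 2 ∂(γ.prod γ) :=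
    hswap (fun z => ‖z.1.1 - z.1.2‖ₑ ^ 2) (by fun_prop)
  -- By swap symmetry, each side is twice one side of `hle'`, with the inequality reversed and
  -- strict.
  have hlt : ∫⁻ z in D, (‖z.1.1 - z.2.2‖ₑ ^ 2 + ‖z.2.1 - z.1.2‖ₑ ^ 2) ∂(γ.prod γ) <
      ∫⁻ z in D, (‖z.1.1 - z.1.2‖ₑ ^ 2 + ‖z.2.1 - z.2.2‖ₑ ^ 2) ∂(γ.prod γ) := by
    refine setLIntegral_strict_mono hDm hne (by fun_prop) ?_ ?_
    · rw [lintegral_add_left (by fun_prop), hs]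
      exact ENNReal.add_ne_top.2 ⟨hX, hX⟩
    · exact Eventually.of_forall fun z hz => sq_enorm_cross_lt hz
  rw [lintegral_add_left (by fun_prop), lintegral_add_left (by fun_prop), hs, hs'] at hlt
  exact hlt.not_ge (add_le_add hle' hle')

/-- The support of an optimal plan is monotone. -/
theorem isMonotoneSet_support {n : ℕ} {μ ν : P2 n} {γ : Measure (E n × E n)}
    (hγ : γ ∈ couplings μ ν)
    (hopt : ∀ γ' ∈ couplings μ ν, ∫⁻ p, ‖p.1 - p.2‖ₑ ^ 2 ∂γ ≤ ∫⁻ p, ‖p.1 - p.2‖ₑ ^ 2 ∂γ') :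
    IsMonotoneSet γ.support := by
  have := isProbabilityMeasure_of_mem_couplings hγ
  intro p hp q hq
  by_contra! h
  have hD : IsOpen {z : (E n × E n) × (E n × E n) | ⟪z.1.1 - z.2.1, z.1.2 - z.2.2⟫ < 0} :=
    isOpen_lt (by fun_prop) (by fun_prop)
  obtain ⟨U, V, hU, hV, hpU, hqV, hUV⟩ := isOpen_prod_iff.1 hD p q h
  have h0 := measure_mono_null hUV (optimal_coupling_prod_null hγ hopt)
  rw [Measure.prod_prod, mul_eq_zero] at h0
  rcases h0 with h0 | h0
  · exact ((Measure.mem_support_iff_forall p).1 hp U (hU.mem_nhds hpU)).ne' h0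
  · exact ((Measure.mem_support_iff_forall q).1 hq V (hV.mem_nhds hqV)).ne' h0

/-! ### From optimal plans to optimal maps -/

theorem memLp_two_of_map_eq {n : ℕ} {σ ρ : P2 n} {T : E n → E n}
    (hT : AEMeasurable T σ.toMeasure) (h : σ.toMeasure.map T = ρ.toMeasure) :
    MemLp T 2 σ.toMeasure := by
  refine ⟨hT.aestronglyMeasurable, (eLpNorm_lt_top_iff_lintegral_rpow_enorm_lt_top two_ne_zero
    ENNReal.ofNat_ne_top).2 ?_⟩
  have := ρ.secondMoment_lt_top
  rw [← h, lintegral_map' (by fun_prop) hT] at this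
  simpa using this

/-- A coupling supported on a monotone set is induced by a map, if its first marginal is
absolutely continuous. -/
theorem exists_map_of_isMonotoneSet_support {n : ℕ} {σ ρ : P2 n} (hσ : σ.toMeasure ≪ volume)
    {γ : Measure (E n × E n)} (hγ : γ ∈ couplings σ ρ) (hmono : IsMonotoneSet γ.support) :
    ∃ T : E n → E n, Measurable T ∧ ∀ᵐ p ∂γ, p.2 = T p.1 := by
  have := isProbabilityMeasure_of_mem_couplings hγ
  have hfst : γ.fst = σ.toMeasure := hγ.1
  have hdis : σ.toMeasure ⊗ₘ γ.condKernel = γ := by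
    rw [← hfst]; exact γ.disintegrate γ.condKernel
  -- The barycentre is a measurable selection: almost every fibre measure is a point mass, whose
  -- mean is that point.
  let T : E n → E n := fun x => ∫ y, y ∂(γ.condKernel x)
  have hT : Measurable T :=
    (StronglyMeasurable.integral_kernel (κ := γ.condKernel) stronglyMeasurable_id).measurable
  refine ⟨T, hT, ?_⟩
  have h1 : ∀ᵐ p ∂(σ.toMeasure ⊗ₘ γ.condKernel), p ∈ γ.support := by
    rw [hdis]; exact Measure.support_mem_ae
  have h2 := Measure.ae_ae_of_ae_compProd h1
  have h3 : ∀ᵐ x ∂σ.toMeasure, ¬ ∃ y z, (x, y) ∈ γ.support ∧ (x, z) ∈ γ.support ∧ y ≠ z := by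
    rw [ae_iff]
    simpa only [not_not] using hσ hmono.volume_multivalued
  rw [← hdis, Measure.ae_compProd_iff (measurableSet_eq_fun (by fun_prop) (by fun_prop))]
  filter_upwards [h2, h3] with x hx hx'
  obtain ⟨y₀, hy₀⟩ := hx.exists
  have hy : ∀ᵐ y ∂(γ.condKernel x), y = y₀ := by
    filter_upwards [hx] with y hy
    by_contra hne
    exact hx' ⟨y, y₀, hy, hy₀, hne⟩
  have hTx : T x = y₀ := by
    simp only [T]
    rw [integral_congr_ae hy]
    simp
  rw [hTx]
  exact hy

/-- For an absolutely continuous source measure there is an optimal transport map. -/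
theorem exists_isOptimalMap {n : ℕ} {σ : P2 n} (hσ : σ.toMeasure ≪ volume) (ρ : P2 n) :
    ∃ T : L2 σ, IsOptimalMap σ ρ T := by
  obtain ⟨γ, hγ, hopt⟩ := exists_optimal_coupling σ ρ
  obtain ⟨T, hT, hγT⟩ :=
    exists_map_of_isMonotoneSet_support hσ hγ (isMonotoneSet_support hγ hopt)
  have hmap : σ.toMeasure.map T = ρ.toMeasure := by
    rw [← hγ.1, ← hγ.2, Measure.map_map hT measurable_fst]
    exact (Measure.map_congr hγT).symm
  have hT2 := memLp_two_of_map_eq hT.aemeasurable hmap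
  refine ⟨hT2.toLp T, by rw [Measure.map_congr hT2.coeFn_toLp, hmap], fun S hS hSρ => ?_⟩
  calc ∫⁻ x, ‖hT2.toLp T x - x‖ₑ ^ 2 ∂σ.toMeasure
      = ∫⁻ x, ‖T x - x‖ₑ ^ 2 ∂σ.toMeasure := by
        refine lintegral_congr_ae ?_
        filter_upwards [hT2.coeFn_toLp] with x hx
        rw [hx]
    _ = ∫⁻ p, ‖p.1 - p.2‖ₑ ^ 2 ∂γ := by
        rw [← hγ.1, lintegral_map (by fun_prop) measurable_fst]
        refine lintegral_congr_ae ?_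
        filter_upwards [hγT] with p hp
        rw [hp, enorm_sub_rev]
    _ ≤ ∫⁻ p, ‖p.1 - p.2‖ₑ ^ 2 ∂(σ.toMeasure.map fun x => (x, S x)) := by
        refine hopt _ ⟨?_, ?_⟩
        · rw [Measure.map_map measurable_fst (by fun_prop)]
          exact Measure.map_id
        · rw [Measure.map_map measurable_snd (by fun_prop)]
          exact hSρ
    _ = ∫⁻ x, ‖S x - x‖ₑ ^ 2 ∂σ.toMeasure := by
        rw [lintegral_map (by fun_prop) (by fun_prop)]
        simp only [enorm_sub_rev]

theorem map_F {n : ℕ} {σ : P2 n} (hσ : σ.toMeasure ≪ volume) (ρ : P2 n) :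
    σ.toMeasure.map (F σ ρ) = ρ.toMeasure :=
  (Classical.epsilon_spec (exists_isOptimalMap hσ ρ)).1

/-! ### Metric properties of the Wasserstein distance -/

theorem W2_le {n : ℕ} {μ ν : P2 n} {γ : Measure (E n × E n)} (hγ : γ ∈ couplings μ ν) :
    W2 μ ν ≤ (∫⁻ p, ‖p.1 - p.2‖ₑ ^ 2 ∂γ) ^ (1 / 2 : ℝ) :=
  ENNReal.rpow_le_rpow (iInf₂_le γ hγ) (by norm_num)

theorem exists_coupling_of_W2_lt {n : ℕ} {μ ν : P2 n} {r : ℝ≥0∞} (h : W2 μ ν < r) :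
    ∃ γ ∈ couplings μ ν, (∫⁻ p, ‖p.1 - p.2‖ₑ ^ 2 ∂γ) ^ (1 / 2 : ℝ) < r := by
  by_contra! hc
  refine h.not_ge ?_
  have hr : r = (r ^ (2 : ℝ)) ^ (1 / 2 : ℝ) := by rw [← ENNReal.rpow_mul]; norm_num
  rw [W2, hr]
  refine ENNReal.rpow_le_rpow (le_iInf₂ fun γ hγ => ?_) (by norm_num)
  have := ENNReal.rpow_le_rpow (hc γ hγ) (z := 2) (by norm_num)
  rwa [← ENNReal.rpow_mul, show (1 / 2 : ℝ) * 2 = 1 by norm_num, ENNReal.rpow_one] at this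

/-- Two couplings with a common marginal can be glued together. -/
theorem exists_gluing {n : ℕ} {μ ν τ : P2 n} {γ γ' : Measure (E n × E n)}
    (hγ : γ ∈ couplings μ ν) (hγ' : γ' ∈ couplings ν τ) :
    ∃ π : Measure ((E n × E n) × E n), π.map Prod.fst = γ ∧
      π.map (fun z => (z.1.2, z.2)) = γ' := by
  have := isProbabilityMeasure_of_mem_couplings hγ
  have := isProbabilityMeasure_of_mem_couplings hγ'
  -- The outer coordinates are made conditionally independent given the middle one.
  refine ⟨γ ⊗ₘ (γ'.condKernel.comap Prod.snd measurable_snd), ?_, ?_⟩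
  · exact Measure.fst_compProd γ _
  · refine Measure.ext_of_lintegral _ fun f hf => ?_
    have hfst : γ'.fst = γ.map Prod.snd := hγ'.1.trans hγ.2.symm
    conv_rhs => rw [← γ'.disintegrate γ'.condKernel]
    rw [lintegral_map hf (by fun_prop), Measure.lintegral_compProd (by fun_prop),
      Measure.lintegral_compProd hf, hfst,
      lintegral_map hf.lintegral_kernel_prod_right' measurable_snd]
    simp only [Kernel.coe_comap, Function.comp_apply]

/-- Glue almost optimal plans along `ν` and apply Minkowski's inequality in L² of the glued measure.
-/
theorem W2_triangle {n : ℕ} (μ ν τ : P2 n) : W2 μ τ ≤ W2 μ ν + W2 ν τ := by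
  refine ENNReal.le_of_forall_pos_le_add fun ε hε hlt => ?_
  obtain ⟨h1, h2⟩ := ENNReal.add_lt_top.1 hlt
  have hε2 : ((ε : ℝ≥0∞) / 2) ≠ 0 := by simpa using hε.ne'
  obtain ⟨γ, hγ, hγr⟩ := exists_coupling_of_W2_lt (ENNReal.lt_add_right h1.ne hε2)
  obtain ⟨γ', hγ', hγr'⟩ := exists_coupling_of_W2_lt (ENNReal.lt_add_right h2.ne hε2)
  obtain ⟨π, hπ, hπ'⟩ := exists_gluing hγ hγ'
  have hmem : π.map (fun z => (z.1.1, z.2)) ∈ couplings μ τ := by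
    constructor
    · rw [Measure.map_map measurable_fst (by fun_prop), ← hγ.1, ← hπ,
        Measure.map_map measurable_fst measurable_fst]
      rfl
    · rw [Measure.map_map measurable_snd (by fun_prop), ← hγ'.2, ← hπ',
        Measure.map_map measurable_snd (by fun_prop)]
      rfl
  have hM := ENNReal.lintegral_Lp_add_le (μ := π) (p := 2)
    (f := fun z => ‖z.1.1 - z.1.2‖ₑ) (g := fun z => ‖z.1.2 - z.2‖ₑ)
    (by fun_prop) (by fun_prop) (by norm_num)
  simp only [ENNReal.rpow_two, Pi.add_apply] at hM
  calc W2 μ τ ≤ (∫⁻ z, ‖z.1.1 - z.2‖ₑ ^ 2 ∂π) ^ (1 / 2 : ℝ) := by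
        have := W2_le hmem
        rwa [lintegral_map (by fun_prop) (by fun_prop)] at this
    _ ≤ (∫⁻ z, (‖z.1.1 - z.1.2‖ₑ + ‖z.1.2 - z.2‖ₑ) ^ 2 ∂π) ^ (1 / 2 : ℝ) := by
        refine ENNReal.rpow_le_rpow (lintegral_mono fun z => ?_) (by norm_num)
        gcongr
        rw [← sub_add_sub_cancel z.1.1 z.1.2 z.2]
        exact enorm_add_le _ _
    _ ≤ (∫⁻ z, ‖z.1.1 - z.1.2‖ₑ ^ 2 ∂π) ^ (1 / 2 : ℝ) +
        (∫⁻ z, ‖z.1.2 - z.2‖ₑ ^ 2 ∂π) ^ (1 / 2 : ℝ) := hM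
    _ ≤ (W2 μ ν + ε / 2) + (W2 ν τ + ε / 2) := by
        rw [← hπ, lintegral_map (by fun_prop) measurable_fst] at hγr
        rw [← hπ', lintegral_map (by fun_prop) (by fun_prop)] at hγr'
        exact add_le_add hγr.le hγr'.le
    _ = W2 μ ν + W2 ν τ + ε := by
        rw [add_add_add_comm, ENNReal.add_halves]

theorem W2_le_edist {n : ℕ} {σ μ ν : P2 n} {S T : L2 σ}
    (hS : σ.toMeasure.map S = μ.toMeasure) (hT : σ.toMeasure.map T = ν.toMeasure) :
    W2 μ ν ≤ edist S T := by
  have hSm : AEMeasurable S σ.toMeasure := (Lp.aestronglyMeasurable S).aemeasurable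
  have hTm : AEMeasurable T σ.toMeasure := (Lp.aestronglyMeasurable T).aemeasurable
  have hmem : σ.toMeasure.map (fun x => (S x, T x)) ∈ couplings μ ν := by
    constructor
    · rw [AEMeasurable.map_map_of_aemeasurable (by fun_prop) (hSm.prodMk hTm)]
      exact hS
    · rw [AEMeasurable.map_map_of_aemeasurable (by fun_prop) (hSm.prodMk hTm)]
      exact hT
  refine (W2_le hmem).trans_eq ?_
  rw [lintegral_map' (by fun_prop) (hSm.prodMk hTm), Lp.edist_def,
    eLpNorm_eq_lintegral_rpow_enorm_toReal two_ne_zero ENNReal.ofNat_ne_top]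
  simp

/-- The topology does not make balls open by definition; the triangle inequality does. -/
theorem isOpen_setOf_W2_lt {n : ℕ} (μ : P2 n) (r : ℝ≥0∞) : IsOpen {ν | W2 μ ν < r} := by
  intro ν hν
  have hν : W2 μ ν < r := hν
  refine ⟨r - W2 μ ν, tsub_pos_of_lt hν, fun τ hτ => ?_⟩
  refine (W2_triangle μ ν τ).trans_lt ?_
  rw [add_comm]
  exact lt_tsub_iff_right.1 hτ

theorem W2_self {n : ℕ} (μ : P2 n) : W2 μ μ = 0 := by
  have hmem : μ.toMeasure.map (fun x => (x, x)) ∈ couplings μ μ := by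
    constructor
    · rw [Measure.map_map measurable_fst (by fun_prop)]
      exact Measure.map_id
    · rw [Measure.map_map measurable_snd (by fun_prop)]
      exact Measure.map_id
  refine le_antisymm ((W2_le hmem).trans ?_) bot_le
  rw [lintegral_map (by fun_prop) (by fun_prop)]
  simp

/-- A compact set has positive Wasserstein distance from a closed set disjoint from it. -/
theorem exists_pos_forall_le_W2 {n : ℕ} {A B : Set (P2 n)} (hA : IsClosed A) (hB : IsCompact B)
    (hAB : Disjoint A B) :
    ∃ δ : ℝ≥0∞, 0 < δ ∧ ∀ ρ ∈ B, ∀ τ ∈ A, δ ≤ W2 ρ τ := by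
  have hball : ∀ ρ ∈ B, ∃ ε : ℝ≥0∞, 0 < ε ∧ ∀ τ, W2 ρ τ < ε → τ ∈ Aᶜ := fun ρ hρ =>
    hA.isOpen_compl ρ fun h => hAB.notMem_of_mem_left h hρ
  choose! ε hε hεA using hball
  obtain ⟨t, htB, ht⟩ := hB.elim_nhds_subcover (fun ρ => {τ | W2 ρ τ < ε ρ / 2}) fun ρ hρ =>
    (isOpen_setOf_W2_lt ρ _).mem_nhds (by
      change W2 ρ ρ < _
      rw [W2_self]
      exact ENNReal.half_pos (hε ρ hρ).ne')
  -- Half radii leave room for the triangle inequality. An empty `t` gives `∞`, which covers empty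
  -- `B`.
  refine ⟨t.inf fun ρ => ε ρ / 2, ?_, fun ρ hρ τ hτ => ?_⟩
  · rw [Finset.lt_inf_iff ENNReal.zero_lt_top]
    exact fun ρ hρ => ENNReal.half_pos (hε ρ (htB ρ hρ)).ne'
  · by_contra! hlt
    obtain ⟨κ, hκ, hκρ⟩ := mem_iUnion₂.1 (ht hρ)
    refine hεA κ (htB κ hκ) τ ?_ hτ
    calc W2 κ τ ≤ W2 κ ρ + W2 ρ τ := W2_triangle _ _ _
      _ < ε κ / 2 + ε κ / 2 :=
        ENNReal.add_lt_add hκρ (hlt.trans_le (Finset.inf_le hκ))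
      _ = ε κ := ENNReal.add_halves _

/-! ### Convexity and separation in L² -/

theorem convex_F_image_orbit {n : ℕ} {σ μ : P2 n} {H : Set (E n → E n)} (hconv : Convex ℝ H)
    (hcomp : Compatible σ μ H) : Convex ℝ (F σ '' orbit H μ) := by
  rintro _ ⟨_, ⟨h, hh, hhm, rfl⟩, rfl⟩ _ ⟨_, ⟨k, hk, hkm, rfl⟩, rfl⟩ a b ha hb hab
  have hmem := hconv hh hk ha hb hab
  obtain ⟨hm, hF⟩ := hcomp _ hmem
  obtain ⟨_, hFh⟩ := hcomp h hh
  obtain ⟨_, hFk⟩ := hcomp k hk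
  refine ⟨_, ⟨_, hmem, hm, rfl⟩, Lp.ext ?_⟩
  filter_upwards [hF, hFh, hFk, Lp.coeFn_add (a • F σ (push h μ hhm)) (b • F σ (push k μ hkm)),
    Lp.coeFn_smul a (F σ (push h μ hhm)), Lp.coeFn_smul b (F σ (push k μ hkm))]
    with x h1 h2 h3 h4 h5 h6
  simp only [h1, h4, Pi.add_apply, h5, h6, Pi.smul_apply, h2, h3, Function.comp_apply]

/-- Convex sets at positive distance from each other are linearly separable. -/
theorem linearlySeparable_of_le_edist {V : Type*} [NormedAddCommGroup V] [InnerProductSpace ℝ V]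
    [CompleteSpace V] {A B : Set V} (hA : Convex ℝ A) (hB : Convex ℝ B) {δ : ℝ≥0∞} (hδ : 0 < δ)
    (h : ∀ y ∈ B, ∀ x ∈ A, δ ≤ edist y x) : LinearlySeparable A B := by
  -- A finite radius is needed, as `δ` may be `∞`. Thickening by `r / 2` keeps the sets convex and
  -- disjoint and makes them open, so both inequalities come out strict.
  obtain ⟨r, hr, hrδ⟩ := ENNReal.lt_iff_exists_nnreal_btwn.1 hδ
  have hr : 0 < (r : ℝ) := by exact_mod_cast hr
  have hdisj : Disjoint (Metric.thickening ((r : ℝ) / 2) A) (Metric.thickening ((r : ℝ) / 2) B) := by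
    rw [Set.disjoint_left]
    intro z hzA hzB
    obtain ⟨x, hx, hzx⟩ := Metric.mem_thickening_iff.1 hzA
    obtain ⟨y, hy, hzy⟩ := Metric.mem_thickening_iff.1 hzB
    have h1 : (r : ℝ≥0∞) < edist y x := hrδ.trans_le (h y hy x hx)
    rw [edist_nndist, ENNReal.coe_lt_coe, ← NNReal.coe_lt_coe, coe_nndist] at h1
    linarith [dist_triangle_left y x z]
  obtain ⟨f, u, hfA, hfB⟩ := geometric_hahn_banach_open_open (hA.thickening _)
    Metric.isOpen_thickening (hB.thickening _) Metric.isOpen_thickening hdisj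
  refine ⟨(InnerProductSpace.toDual ℝ V).symm f, u, fun x hx => ?_, fun y hy => ?_⟩
  · rw [InnerProductSpace.toDual_symm_apply]
    exact hfA x (Metric.self_subset_thickening (by positivity) _ hx)
  · rw [InnerProductSpace.toDual_symm_apply]
    exact hfB y (Metric.self_subset_thickening (by positivity) _ hy)

end LOT

theorem mainTheorem6 (n : ℕ) (σ μ ν : LOT.P2 n) (hσ : σ.toMeasure ≪ volume)
    (H : Set (LOT.E n → LOT.E n))
    (hHσ : ∀ h ∈ H, MemLp h 2 σ.toMeasure)
    (hconv : Convex ℝ H)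
    (hcompμ : LOT.Compatible σ μ H) (hcompν : LOT.Compatible σ ν H)
    (hclosed : IsClosed (LOT.orbit H μ)) (hcompact : IsCompact (LOT.orbit H ν))
    (hdisj : Disjoint (LOT.orbit H μ) (LOT.orbit H ν)) :
    LOT.LinearlySeparable (LOT.F σ '' LOT.orbit H μ) (LOT.F σ '' LOT.orbit H ν) := by
  obtain ⟨δ, hδ, h⟩ := LOT.exists_pos_forall_le_W2 hclosed hcompact hdisj
  refine LOT.linearlySeparable_of_le_edist (LOT.convex_F_image_orbit hconv hcompμ)
    (LOT.convex_F_image_orbit hconv hcompν) hδ ?_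
  rintro _ ⟨ρ, hρ, rfl⟩ _ ⟨τ, hτ, rfl⟩
  exact (h ρ hρ τ hτ).trans (LOT.W2_le_edist (LOT.map_F hσ ρ) (LOT.map_F hσ τ))
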